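/- Let $k$ be an algebraically closed field of characteristic zero. A variety over $k$ means an algebraic variety in the sense of Serre, i.e. a reduced separated scheme of finite type over $k$, not necessarily irreducible. A variety is called toral if it is isomorphic over $k$ to a closed subvariety of $\mathbf{A}^n \setminus \bigcup_{i=1}^n H_i$ for some integer $n \geq 0$, where $H_i$ is the zero set of the $i$th coordinate function on $\mathbf{A}^n$. A group $G$ is called Jordan if there is a positive integer $d$, depending only on $G$, such that every finite subgroup $K$ of $G$ contains a normal abelian subgroup of index at most $d$ in $K$. Theorem. For every variety $X$ over $k$ and every point $x \in X$ there is an open neighborhood $U$ of $x$ in $X$ such that the group $\mathrm{Aut}(U)$ of automorphisms of $U$ over $k$ is Jordan; moreover, $U$ can be chosen to be toral. -/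

import Mathlib

open CategoryTheory AlgebraicGeometry

universe u

/-- A group `G` is Jordan if there is a positive integer `d` such that every finite subgroup `K`
of `G` contains a normal abelian subgroup whose index in `K` is at most `d`. -/
def IsJordanGroup (G : Type*) [Group G] : Prop :=
  ∃ d : ℕ, 0 < d ∧ ∀ K : Subgroup G, Finite K →
    ∃ A : Subgroup K, A.Normal ∧ IsMulCommutative A ∧ A.index ≤ d

/-- An algebraic variety over an algebraically closed field `k`, as a `k`-scheme: reduced,
separated and of finite type over `k`, not necessarily irreducible. -/
structure IsAlgebraicVariety {k : Type u} [Field k] {X : Scheme.{u}}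
    (f : X ⟶ Spec (CommRingCat.of k)) : Prop where
  reduced : IsReduced X
  separated : IsSeparated f
  locallyOfFiniteType : LocallyOfFiniteType f
  quasiCompact : QuasiCompact f

/-- The automorphism group over `k` of a `k`-scheme `f : X ⟶ Spec k`. -/
abbrev AutOver {k : Type u} [Field k] {X : Scheme.{u}}
    (f : X ⟶ Spec (CommRingCat.of k)) : Type u :=
  Aut (Over.mk f)

/-- The affine `n`-space over `k` with coordinates `x₁, …, xₙ`. -/
noncomputable abbrev affineSpaceOver (k : Type u) [Field k] (n : ℕ) : Scheme.{u} :=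
  AffineSpace (ULift.{u} (Fin n)) (Spec (CommRingCat.of k))

/-- The complement in the affine `n`-space of the union of the `n` coordinate hyperplanes. -/
noncomputable def coordinateComplement (k : Type u) [Field k] (n : ℕ) :
    (affineSpaceOver k n).Opens :=
  ⨅ i : ULift.{u} (Fin n),
    (affineSpaceOver k n).basicOpen (AffineSpace.coord (Spec (CommRingCat.of k)) i)

/-- A variety over `k` is toral if it is isomorphic over `k` to a closed subvariety of the
complement of the coordinate hyperplanes in some affine `n`-space. -/
def IsToral {k : Type u} [Field k] {X : Scheme.{u}}
    (f : X ⟶ Spec (CommRingCat.of k)) : Prop :=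
  ∃ (n : ℕ) (j : X ⟶ (coordinateComplement k n).toScheme), IsClosedImmersion j ∧
    j ≫ (coordinateComplement k n).ι ≫ (affineSpaceOver k n ↘ Spec (CommRingCat.of k)) = f

/-! Shrink to an affine `U` around `x` whose functions inject into the local ring at `x` and are
generated by finitely many units; these units embed `U` as a closed subvariety of a torus. Then
`Aut(U)` acts faithfully on the unit group of `O(U)` and fixes the constants.

By Rosenlicht (`exists_units_monoidHom_of_isDomain`), units modulo constants embed in a lattice on
each component. Injectivity at `x` makes all components pass through `x`, which glues these
statements (`exists_units_monoidHom_of_iInf_eq_bot`).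

In a finite group of automorphisms, those trivial on the lattice modulo `3` are trivial on it
(Minkowski, `apply_eq_of_pow_eq_one_of_congr`). They multiply each unit by a constant, hence
commute, and their index is bounded by the order of one fixed finite group
(`isJordanGroup_of_faithful_end`). -/

/-! ### Minkowski's lemma: finite order and congruence to the identity modulo 3 -/

section Minkowski

variable {E ι : Type*} [AddCommGroup E]

/-- The iterated differences of a finite order endomorphism grow at most like `2 ^ m`. -/
lemma abs_apply_pow_sub_one_le (c : E →ₗ[ℤ] ℤ) (σ : Module.End ℤ E) {n : ℕ} (hn : 0 < n)
    (hσ : σ ^ n = 1) (x : E) : ∃ B : ℤ, ∀ m : ℕ, |c (((σ - 1) ^ m) x)| ≤ 2 ^ m * B := by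
  refine ⟨∑ j ∈ Finset.range n, |c ((σ ^ j) x)|, fun m ↦ ?_⟩
  -- The shift by `σ ^ j` makes the induction close: each difference splits into two shifted terms.
  suffices H : ∀ m j : ℕ, |c ((σ ^ j * (σ - 1) ^ m) x)| ≤
      2 ^ m * ∑ j ∈ Finset.range n, |c ((σ ^ j) x)| by simpa using H m 0
  intro m
  induction m with
  | zero =>
    intro j
    have h : σ ^ j = σ ^ (j % n) := by
      conv_lhs => rw [← Nat.mod_add_div j n, pow_add, pow_mul, hσ, one_pow, mul_one]
    simp only [pow_zero, mul_one, one_mul, h]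
    exact Finset.single_le_sum (f := fun j ↦ |c ((σ ^ j) x)|) (fun _ _ ↦ abs_nonneg _)
      (Finset.mem_range.2 (Nat.mod_lt _ hn))
  | succ m ih =>
    intro j
    have h : σ ^ j * (σ - 1) ^ (m + 1) =
        σ ^ (j + 1) * (σ - 1) ^ m - σ ^ j * (σ - 1) ^ m := by
      rw [pow_succ' (σ - 1), pow_succ σ]; noncomm_ring
    have h' : c ((σ ^ j * (σ - 1) ^ (m + 1)) x) =
        c ((σ ^ (j + 1) * (σ - 1) ^ m) x) - c ((σ ^ j * (σ - 1) ^ m) x) := by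
      rw [h, LinearMap.sub_apply, map_sub]
    rw [h', pow_succ (2 : ℤ)]
    have := abs_sub (c ((σ ^ (j + 1) * (σ - 1) ^ m) x)) (c ((σ ^ j * (σ - 1) ^ m) x))
    linarith [ih j, ih (j + 1)]

/-- An endomorphism of finite order that is congruent to the identity modulo `3` in the image of
`c`, and trivial on the kernel of `c`, induces the identity on the image of `c`. -/
lemma apply_eq_of_pow_eq_one_of_congr [Finite ι] (c : E →ₗ[ℤ] (ι → ℤ)) (σ : Module.End ℤ E)
    (hker : ∀ x, c x = 0 → σ x = x) {n : ℕ} (hn : 0 < n) (hσ : σ ^ n = 1)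
    (h3 : ∀ x, ∃ y, c (σ x - x) = c (3 • y)) (x : E) : c (σ x) = c x := by
  let δ := σ - 1
  have δapp (x : E) : δ x = σ x - x := rfl
  have δker (x : E) (hx : c x = 0) : δ x = 0 := by rw [δapp, hker x hx, sub_self]
  have hdvd (x : E) : ∀ m : ℕ, ∃ y, c ((δ ^ m) x) = c (3 ^ m • y) := by
    intro m
    induction m with
    | zero => exact ⟨x, by simp⟩
    | succ m ih =>
      obtain ⟨y, hy⟩ := ih
      obtain ⟨z, hz⟩ := h3 y
      refine ⟨z, ?_⟩
      -- `δ` kills `ker c`, so it agrees on two elements with the same image under `c`.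
      have h0 := δker ((δ ^ m) x - 3 ^ m • y) (by rw [map_sub, hy, sub_self])
      rw [map_sub, sub_eq_zero, map_nsmul, δapp y] at h0
      rw [pow_succ', Module.End.mul_apply, h0, map_nsmul, hz, ← map_nsmul, smul_smul, pow_succ]
  -- `c (δ ^ m x)` is divisible by `3 ^ m` but is `O(2 ^ m)`, so it vanishes for large `m`. Modulo
  -- `2` this would fail, as `-1` shows.
  have hzero (x : E) : ∃ m : ℕ, c ((δ ^ m) x) = 0 := by
    have h1 (i : ι) : ∃ m₀ : ℕ, ∀ m ≥ m₀, c ((δ ^ m) x) i = 0 := by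
      obtain ⟨B, hB⟩ := abs_apply_pow_sub_one_le (LinearMap.proj i ∘ₗ c) σ hn hσ x
      obtain ⟨m₀, hm₀⟩ := pow_unbounded_of_one_lt (B : ℝ) (show (1 : ℝ) < 3 / 2 by norm_num)
      refine ⟨m₀, fun m hm ↦ ?_⟩
      have hlt : (2 : ℤ) ^ m * B < 3 ^ m := by
        have : (B : ℝ) < (3 / 2) ^ m :=
          hm₀.trans_le (pow_le_pow_right₀ (by norm_num) hm)
        rw [div_pow, lt_div_iff₀ (by positivity)] at this
        have h2 : ((2 ^ m * B : ℤ) : ℝ) < ((3 ^ m : ℤ) : ℝ) := by push_cast; linarith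
        exact_mod_cast h2
      obtain ⟨y, hy⟩ := hdvd x m
      refine Int.eq_zero_of_abs_lt_dvd (m := 3 ^ m) ?_ ((hB m).trans_lt hlt)
      rw [hy, map_nsmul]
      exact ⟨c y i, by simp⟩
    choose f hf using h1
    have := Fintype.ofFinite ι
    exact ⟨∑ i, f i, funext fun i ↦
      hf i _ (Finset.single_le_sum (f := f) (fun _ _ ↦ Nat.zero_le _) (Finset.mem_univ i))⟩
  -- If `c` does not see `δ (δ y)`, then `c (σ ^ j y)` is affine in `j` with slope `c (δ y)`; `σ ^ n
  -- = 1` makes the slope zero.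
  have hdesc (y : E) (hy : c (δ (δ y)) = 0) : c (δ y) = 0 := by
    have h1 (j : ℕ) : c ((σ ^ j) (δ y)) = c (δ y) := by
      induction j with
      | zero => simp
      | succ j ih =>
        have hfix : (σ ^ j) (δ (δ y)) = δ (δ y) := by
          clear ih
          induction j with
          | zero => simp
          | succ j ih => rw [pow_succ, Module.End.mul_apply, hker _ hy, ih]
        rw [pow_succ, Module.End.mul_apply,
          show σ (δ y) = δ y + δ (δ y) by rw [δapp (δ y)]; abel, map_add, map_add, ih, hfix, hy,
          add_zero]
    have h2 (j : ℕ) : c ((σ ^ j) y) = c y + j • c (δ y) := by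
      induction j with
      | zero => simp
      | succ j ih =>
        rw [pow_succ, Module.End.mul_apply, show σ y = y + δ y by rw [δapp]; abel, map_add,
          map_add, ih, h1, succ_nsmul, add_assoc]
    have h3 := h2 n
    rw [hσ, Module.End.one_apply, left_eq_add] at h3
    exact (smul_eq_zero.1 h3).resolve_left hn.ne'
  have hone (m : ℕ) (x : E) (h : c ((δ ^ (m + 1)) x) = 0) : c (δ x) = 0 := by
    induction m with
    | zero => simpa using h
    | succ m ih =>
      refine ih ?_
      rw [pow_succ', Module.End.mul_apply]
      refine hdesc _ ?_
      rwa [pow_succ', pow_succ', Module.End.mul_apply, Module.End.mul_apply] at h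
  -- Using `δ x` instead of `x` ensures a positive exponent.
  obtain ⟨m, hm⟩ := hzero (δ x)
  have := hone m x (by rwa [pow_succ, Module.End.mul_apply])
  rwa [δapp, map_sub, sub_eq_zero] at this

end Minkowski

/-! ### Jordan groups -/

/-- A group acting faithfully on an abelian group `E`, trivially on the kernel of a homomorphism
from `E` to a lattice, is Jordan. -/
lemma isJordanGroup_of_faithful_end {G E ι : Type*} [Group G] [AddCommGroup E] [Finite ι]
    (ρ : G →* Module.End ℤ E) (hρ : Function.Injective ρ) (c : E →ₗ[ℤ] (ι → ℤ))
    (hker : ∀ g x, c x = 0 → ρ g x = x) : IsJordanGroup G := by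
  let N : Submodule ℤ (ι → ℤ) := LinearMap.range c
  let T : Submodule ℤ N := Ideal.span {(3 : ℤ)} • (⊤ : Submodule ℤ N)
  -- `E ⧸ W` embeds in `N ⧸ 3N`, finite since `N` is finitely generated, although `E` itself need
  -- not be.
  let W : Submodule ℤ E := T.comap c.rangeRestrict
  have memW (x : E) : x ∈ W ↔ ∃ y, c x = c (3 • y) := by
    change c.rangeRestrict x ∈ Ideal.span {(3 : ℤ)} • (⊤ : Submodule ℤ N) ↔ _
    rw [Submodule.ideal_span_singleton_smul, Submodule.mem_smul_pointwise_iff_exists]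
    constructor
    · rintro ⟨⟨_, y, rfl⟩, -, h⟩
      refine ⟨y, ?_⟩
      rw [map_nsmul]
      simpa using (congrArg Subtype.val h).symm
    · rintro ⟨y, hy⟩
      refine ⟨c.rangeRestrict y, trivial, Subtype.ext ?_⟩
      rw [map_nsmul] at hy
      simpa using hy.symm
  have hfin : Finite (N ⧸ T) := by
    have : Finite (ℤ ⧸ Ideal.span {(3 : ℤ)}) :=
      Finite.of_equiv _ (Int.quotientSpanNatEquivZMod 3).symm.toEquiv
    exact Submodule.finite_quotient_smul _ (IsNoetherian.noetherian _)
  have hfinW : Finite (E ⧸ W) := by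
    refine Finite.of_injective (W.mapQ T c.rangeRestrict le_rfl) (LinearMap.ker_eq_bot.1 ?_)
    exact Submodule.ker_liftQ_eq_bot _ _ _ (by rw [LinearMap.ker_comp, Submodule.ker_mkQ])
  have hW (g : G) : W ≤ W.comap (ρ g) := by
    intro x hx
    obtain ⟨y, hy⟩ := (memW x).1 hx
    refine (memW _).2 ⟨ρ g y, ?_⟩
    have h := hker g (x - 3 • y) (by rw [map_sub, hy, sub_self])
    rw [map_sub, sub_eq_iff_eq_add, map_nsmul] at h
    rw [h, map_add, map_sub, hy, sub_self, zero_add]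
  let Θ : G →* Module.End ℤ (E ⧸ W) :=
    { toFun g := W.mapQ W (ρ g) (hW g)
      map_one' := by
        ext x
        simp
      map_mul' g h := by
        ext x
        simp }
  have hfinEnd : Finite (Module.End ℤ (E ⧸ W)) := DFunLike.finite _
  refine ⟨Nat.card (Module.End ℤ (E ⧸ W))ˣ, Nat.card_pos, fun K _ ↦
    ⟨(Θ.toHomUnits.comp K.subtype).ker, inferInstance, ⟨⟨?_⟩⟩, ?_⟩⟩
  · have key (g : (Θ.toHomUnits.comp K.subtype).ker) (x : E) : c (ρ g x) = c x := by
      refine apply_eq_of_pow_eq_one_of_congr c (ρ g) (hker g)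
        (n := orderOf (g : K)) (orderOf_pos _) ?_ (fun x ↦ ?_) x
      · rw [← map_pow, ← Subgroup.coe_pow, pow_orderOf_eq_one, Subgroup.coe_one, map_one]
      · rw [← memW]
        have h := congrArg Units.val (MonoidHom.mem_ker.1 g.2)
        have h2 : W.mkQ (ρ g x) = W.mkQ x := LinearMap.congr_fun h (W.mkQ x)
        rwa [← sub_eq_zero, ← map_sub, Submodule.mkQ_apply, Submodule.Quotient.mk_eq_zero] at h2
    intro a b
    refine Subtype.ext (Subtype.ext (hρ ?_))
    -- `ρ b x - x` lies in `ker c`, so `a` fixes it; the resulting formula is symmetric in `a` and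
    -- `b`.
    have hcomm (a b : (Θ.toHomUnits.comp K.subtype).ker) (x : E) :
        ρ a (ρ b x) = ρ a x + (ρ b x - x) := by
      have h := hker a (ρ b x - x) (by rw [map_sub, key, sub_self])
      rw [map_sub, sub_eq_iff_eq_add] at h
      rw [h, add_comm]
    ext x
    simp only [Subgroup.coe_mul, map_mul, Module.End.mul_apply]
    rw [hcomm, hcomm]
    abel
  · rw [Subgroup.index_ker]
    exact Nat.card_le_card_of_injective _ Subtype.val_injective

/-- Jordan groups are stable under passing to a group that embeds. -/
lemma IsJordanGroup.of_injective {G H : Type*} [Group G] [Group H] (f : G →* H)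
    (hf : Function.Injective f) (hH : IsJordanGroup H) : IsJordanGroup G := by
  obtain ⟨d, hd, h⟩ := hH
  refine ⟨d, hd, fun K _ ↦ ?_⟩
  let e := K.equivMapOfInjective f hf
  obtain ⟨A, hA, hcomm, hidx⟩ := h (K.map f) (Finite.of_equiv _ e.toEquiv)
  refine ⟨A.comap e.toMonoidHom, inferInstance, ⟨⟨fun a b ↦ ?_⟩⟩, ?_⟩
  · have := congrArg Subtype.val (hcomm.1.1 ⟨e a, a.2⟩ ⟨e b, b.2⟩)
    refine Subtype.ext (e.injective ?_)
    change e (a * b) = e (b * a)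
    rw [map_mul, map_mul]
    exact this
  · rwa [Subgroup.index_comap_of_surjective _ e.surjective]

/-! ### The valuation at the hyperplane at infinity -/

section DegreeValuation

open WithZero

variable (σ k : Type*) [Field k]

open Classical in
/-- The valuation on a polynomial ring over a field given by the total degree. -/
noncomputable def totalDegreeValuation :
    Valuation (MvPolynomial σ k) (WithZero (Multiplicative ℤ)) where
  toFun p := if p = 0 then 0 else exp (p.totalDegree : ℤ)
  map_zero' := if_pos rfl
  map_one' := by simp
  map_mul' p q := by
    by_cases hp : p = 0
    · simp [hp]
    by_cases hq : q = 0
    · simp [hq]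
    rw [if_neg hp, if_neg hq, if_neg (mul_ne_zero hp hq),
      MvPolynomial.totalDegree_mul_of_isDomain hp hq, ← exp_add, Nat.cast_add]
  map_add_le_max' p q := by
    by_cases hp : p = 0
    · simp [hp]
    by_cases hq : q = 0
    · simp [hq]
    by_cases hpq : p + q = 0
    · simp [hpq]
    rw [if_neg hp, if_neg hq, if_neg hpq, le_max_iff, exp_le_exp, exp_le_exp, Nat.cast_le,
      Nat.cast_le, ← le_max_iff]
    exact MvPolynomial.totalDegree_add _ _

variable {σ k}

lemma totalDegreeValuation_apply {p : MvPolynomial σ k} (hp : p ≠ 0) :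
    totalDegreeValuation σ k p = exp (p.totalDegree : ℤ) := if_neg hp

/-- There is a discrete valuation ring of `k(σ)`, the one at the hyperplane at infinity, whose only
polynomials are the constants. -/
lemma exists_isDiscreteValuationRing_forall_mem_eq_C [Nonempty σ] (K : Type*) [Field K]
    [Algebra (MvPolynomial σ k) K] [IsFractionRing (MvPolynomial σ k) K] :
    ∃ O : ValuationSubring K, IsDiscreteValuationRing O ∧
      ∀ p : MvPolynomial σ k, algebraMap _ K p ∈ O → ∃ c, p = MvPolynomial.C c := by
  have hS : nonZeroDivisors (MvPolynomial σ k) ≤ (totalDegreeValuation σ k).supp.primeCompl := by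
    intro p hp h
    have h' : totalDegreeValuation σ k p = 0 := h
    rw [totalDegreeValuation_apply (nonZeroDivisors.ne_zero hp)] at h'
    exact exp_ne_zero h'
  let v := (totalDegreeValuation σ k).extendToLocalization hS K
  have hv (p) : v (algebraMap _ K p) = totalDegreeValuation σ k p :=
    Valuation.extendToLocalization_apply_map_apply _ _ _ _
  have hnt : v.IsNontrivial := by
    obtain ⟨i⟩ := ‹Nonempty σ›
    refine ⟨⟨algebraMap (MvPolynomial σ k) K (MvPolynomial.X i), ?_, ?_⟩⟩
    · rw [hv, totalDegreeValuation_apply (MvPolynomial.X_ne_zero i)]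
      exact exp_ne_zero
    · rw [hv, totalDegreeValuation_apply (MvPolynomial.X_ne_zero i), MvPolynomial.totalDegree_X,
        ← exp_zero]
      exact exp_injective.ne (by norm_num)
  refine ⟨v.valuationSubring, ?_, fun p hp ↦ ?_⟩
  -- A nontrivial valuation with values in `ℤ` is discrete.
  · infer_instance
  · rcases eq_or_ne p 0 with rfl | h0
    · exact ⟨0, by simp⟩
    rw [Valuation.mem_valuationSubring_iff, hv, totalDegreeValuation_apply h0, ← exp_zero,
      exp_le_exp] at hp
    exact ⟨_, MvPolynomial.totalDegree_eq_zero_iff_eq_C.1 (by omega)⟩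

end DegreeValuation

/-! ### Rosenlicht's unit theorem -/

open IsDedekindDomain in
/-- The units of a finite separable extension of the fraction field of a discrete valuation ring
`O` map to a lattice in such a way that the elements of the kernel are integral over `O`. -/
lemma exists_monoidHom_isIntegral_of_mem_ker.{v} (O K : Type*) (F : Type v) [CommRing O]
    [IsDomain O] [IsDiscreteValuationRing O] [Field K] [Algebra O K] [IsFractionRing O K] [Field F] [Algebra K F]
    [Algebra O F] [IsScalarTower O K F] [FiniteDimensional K F] [Algebra.IsSeparable K F] :
    ∃ (ι : Type v) (_ : Finite ι) (φ : Fˣ →* Multiplicative (ι → ℤ)),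
      ∀ u, φ u = 1 → IsIntegral O (u : F) := by
  let D := integralClosure O F
  have : IsFractionRing D F := IsIntegralClosure.isFractionRing_of_finite_extension O K F D
  have : IsDedekindDomain D := IsIntegralClosure.isDedekindDomain O K F D
  have hinj : Function.Injective (algebraMap O D) := by
    have h : Function.Injective (algebraMap O F) := by
      rw [IsScalarTower.algebraMap_eq O K F]
      exact (algebraMap K F).injective.comp (IsFractionRing.injective O K)
    exact fun a b hab ↦ h (congrArg (algebraMap D F) hab)
  have : Module.IsTorsionFree O D := by
    have := (faithfulSMul_iff_algebraMap_injective O D).2 hinj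
    infer_instance
  -- By integrality every nonzero prime of `D` lies over the maximal ideal of `O`, and only finitely
  -- many do.
  have hfin : Finite (HeightOneSpectrum D) := by
    have h := IsDedekindDomain.primesOver_finite (IsLocalRing.maximalIdeal O) (B := D)
    have := h.to_subtype
    refine Finite.of_injective
      (fun v : HeightOneSpectrum D ↦
        (⟨v.asIdeal, v.isPrime, ⟨?_⟩⟩ : Ideal.primesOver (IsLocalRing.maximalIdeal O) D)) ?_
    · have := Ideal.IsMaximal.under O v.asIdeal
      exact (IsLocalRing.eq_maximalIdeal this).symm
    · intro v w h
      exact HeightOneSpectrum.ext (congrArg Subtype.val h)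
  refine ⟨HeightOneSpectrum D, hfin,
    { toFun u := Multiplicative.ofAdd fun v ↦ (v.valuationOfNeZero u).toAdd
      map_one' := by simp; rfl
      map_mul' x y := by simp; rfl }, fun u hu ↦ ?_⟩
  obtain ⟨d, hd⟩ := HeightOneSpectrum.mem_integers_of_valuation_le_one (R := D) F (u : F) (fun v ↦ by
    have h : (v.valuationOfNeZero u).toAdd = 0 := congrFun (congrArg Multiplicative.toAdd hu) v
    rw [← HeightOneSpectrum.valuationOfNeZero_eq, show v.valuationOfNeZero u = 1 from h]
    rfl)
  rw [← hd]
  exact d.2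

/-- An element of an extension of the fraction field of `k[σ]` is algebraic over `k` if it is
integral over `k[σ]` and over a valuation ring whose only polynomials are the constants. -/
lemma isIntegral_of_forall_mem_eq_C {σ k K F : Type*} [Field k] [Field K] [Field F]
    [Algebra (MvPolynomial σ k) K] [IsFractionRing (MvPolynomial σ k) K] [Algebra K F]
    [Algebra (MvPolynomial σ k) F] [IsScalarTower (MvPolynomial σ k) K F]
    [Algebra k F] [IsScalarTower k (MvPolynomial σ k) F]
    (O : ValuationSubring K) [Algebra O F] [IsScalarTower O K F]
    (hO : ∀ p : MvPolynomial σ k, algebraMap _ K p ∈ O → ∃ c, p = MvPolynomial.C c) (x : F)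
    (h₁ : IsIntegral (MvPolynomial σ k) x) (h₂ : IsIntegral O x) : IsIntegral k x := by
  -- Both base rings are integrally closed, so both minimal polynomials become the one over `K`; its
  -- coefficients lie in `k[σ] ∩ O = k`.
  have e₁ := minpoly.isIntegrallyClosed_eq_field_fractions' K h₁
  have e₂ := minpoly.isIntegrallyClosed_eq_field_fractions' K h₂
  have hmem (i : ℕ) : (minpoly (MvPolynomial σ k) x).coeff i ∈
      (algebraMap k (MvPolynomial σ k)).range := by
    obtain ⟨c, hc⟩ := hO ((minpoly (MvPolynomial σ k) x).coeff i) (by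
      rw [← Polynomial.coeff_map, ← e₁, e₂, Polynomial.coeff_map]
      exact ((minpoly O x).coeff i).2)
    exact ⟨c, hc.symm⟩
  obtain ⟨q, hq, -, hmonic⟩ := Polynomial.lifts_and_natDegree_eq_and_monic
    ((Polynomial.lifts_iff_coeff_lifts _).2 hmem) (minpoly.monic h₁)
  refine ⟨q, hmonic, ?_⟩
  rw [IsScalarTower.algebraMap_eq k (MvPolynomial σ k) F, ← Polynomial.eval₂_map, hq]
  exact minpoly.aeval _ _

lemma exists_algebraMap_eq_of_isIntegral {k A : Type*} [Field k] [IsAlgClosed k] [CommRing A]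
    [IsDomain A] [Algebra k A] {x : A} (hx : IsIntegral k x) : ∃ c, algebraMap k A c = x :=
  minpoly.mem_range_of_degree_eq_one k x
    (IsAlgClosed.degree_eq_one_of_irreducible k (minpoly.irreducible hx))

/-- Rosenlicht's unit theorem: modulo constants, the units of a finitely generated domain over an
algebraically closed field embed in a lattice. -/
lemma exists_units_monoidHom_of_isDomain {k : Type*} {A : Type u} [Field k] [IsAlgClosed k]
    [CharZero k] [CommRing A] [IsDomain A] [Algebra k A] [Algebra.FiniteType k A] :
    ∃ (ι : Type u) (_ : Finite ι) (φ : Aˣ →* Multiplicative (ι → ℤ)),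
      ∀ u, φ u = 1 → ∃ c, algebraMap k A c = u := by
  obtain ⟨s, g, hg, hgfin⟩ := exists_finite_inj_algHom_of_fg k A
  -- Without variables there is no hyperplane at infinity, but then `A` is integral over `k`.
  rcases Nat.eq_zero_or_pos s with rfl | hs
  · refine ⟨PEmpty, inferInstance, 1, fun u _ ↦ exists_algebraMap_eq_of_isIntegral ?_⟩
    obtain ⟨p, hp, hpu⟩ := hgfin.to_isIntegral (u : A)
    have hgk : (g : MvPolynomial (Fin 0) k →+* A) =
        (algebraMap k A).comp (MvPolynomial.isEmptyRingEquiv k (Fin 0)) := by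
      refine MvPolynomial.ringHom_ext (fun c ↦ ?_) fun i ↦ i.elim0
      refine (g.commutes c).trans ?_
      simp only [RingHom.comp_apply, RingHom.coe_coe]
      exact congrArg _ (MvPolynomial.coeff_zero_C c).symm
    refine ⟨p.map (MvPolynomial.isEmptyRingEquiv k (Fin 0) : MvPolynomial (Fin 0) k →+* k),
      hp.map _, ?_⟩
    rw [Polynomial.eval₂_map, ← hgk]
    exact hpu
  have : Nonempty (Fin s) := ⟨⟨0, hs⟩⟩
  let R := MvPolynomial (Fin s) k
  let K := FractionRing R
  let F := FractionRing A
  algebraize [(g : R →+* A)]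
  have : IsScalarTower k R A := .of_algebraMap_eq' g.comp_algebraMap.symm
  have : FaithfulSMul R A := (faithfulSMul_iff_algebraMap_injective R A).2 hg
  have : FaithfulSMul R F := .trans R A F
  let : Algebra K F := FractionRing.liftAlgebra R F
  have : IsScalarTower R K F := FractionRing.isScalarTower_liftAlgebra R F
  have : Module.Finite R A := hgfin
  have : FiniteDimensional K F := inferInstance
  -- Characteristic zero makes `F` separable over `K`.
  have : CharZero R := charZero_of_injective_algebraMap (MvPolynomial.C_injective (Fin s) k)
  have : CharZero K := charZero_of_injective_algebraMap (IsFractionRing.injective R K)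
  obtain ⟨O, hO, hOC⟩ := exists_isDiscreteValuationRing_forall_mem_eq_C (σ := Fin s) (k := k) K
  obtain ⟨ι, hι, φ, hφ⟩ := exists_monoidHom_isIntegral_of_mem_ker O K F
  refine ⟨ι, hι, φ.comp (Units.map (algebraMap A F)), fun u hu ↦
    exists_algebraMap_eq_of_isIntegral ?_⟩
  have h₁ : IsIntegral R (algebraMap A F u) := (Algebra.IsIntegral.isIntegral (u : A)).algebraMap
  have h := isIntegral_of_forall_mem_eq_C O hOC _ h₁ (hφ _ hu)
  exact (isIntegral_algebraMap_iff (IsFractionRing.injective A F)).1 h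

/-- `kˣ` is divisible, while an integer `n` divisible by `|n| + 1` is zero. -/
lemma MonoidHom.eq_one_of_units_isAlgClosed {k ι : Type*} [Field k] [IsAlgClosed k]
    (φ : kˣ →* Multiplicative (ι → ℤ)) : φ = 1 := by
  ext c i
  set n := (φ c).toAdd i with hn
  obtain ⟨b, hb⟩ := IsAlgClosed.exists_pow_nat_eq (c : k) (n := n.natAbs + 1) (by omega)
  have hb0 : b ≠ 0 := by
    rintro rfl
    simp at hb
    exact c.ne_zero hb.symm
  have h : c = (Units.mk0 b hb0) ^ (n.natAbs + 1) := Units.ext (by simp [hb])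
  have h2 : n = (n.natAbs + 1 : ℕ) * (φ (Units.mk0 b hb0)).toAdd i := by
    conv_lhs => rw [hn, h, map_pow]
    simp
  have h3 : n = 0 := Int.eq_zero_of_abs_lt_dvd ⟨_, h2⟩ (by rw [Int.abs_eq_natAbs]; omega)
  exact h3

/-- If an algebra has a finite separating family of prime ideals, all contained in one prime ideal,
its units modulo constants embed in a lattice. -/
lemma exists_units_monoidHom_of_iInf_eq_bot {k : Type*} {A : Type u} [Field k] [IsAlgClosed k]
    [CharZero k] [CommRing A] [Algebra k A] [Algebra.FiniteType k A] (p : Ideal A) [hp : p.IsPrime]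
    (S : Set (Ideal A)) (hS : S.Finite) (hSprime : ∀ q ∈ S, q.IsPrime) (hSp : ∀ q ∈ S, q ≤ p)
    (hS0 : sInf S = ⊥) :
    ∃ (ι : Type u) (_ : Finite ι) (φ : Aˣ →* Multiplicative (ι → ℤ)),
      ∀ u, φ u = 1 ↔ ∃ c, algebraMap k A c = u := by
  have h (q : S) : ∃ (ι : Type u) (_ : Finite ι) (φ : (A ⧸ q.1)ˣ →* Multiplicative (ι → ℤ)),
      ∀ u, φ u = 1 → ∃ c, algebraMap k (A ⧸ q.1) c = u := by
    have := hSprime q q.2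
    exact exists_units_monoidHom_of_isDomain
  choose ι hι φ hφ using h
  have := hS.to_subtype
  let ψ : Aˣ →* Multiplicative ((Σ q : S, ι q) → ℤ) :=
    { toFun u := Multiplicative.ofAdd fun i ↦
        (φ i.1 (Units.map (Ideal.Quotient.mk i.1.1 : A →* A ⧸ i.1.1) u)).toAdd i.2
      map_one' := by simp; rfl
      map_mul' x y := by simp; rfl }
  refine ⟨Σ q : S, ι q, inferInstance, ψ, fun u ↦ ⟨fun hu ↦ ?_, ?_⟩⟩
  · have hc (q : S) : ∃ c, (u : A) - algebraMap k A c ∈ q.1 := by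
      obtain ⟨c, hc⟩ := hφ q (Units.map (Ideal.Quotient.mk q.1 : A →* A ⧸ q.1) u)
        (funext fun i ↦ congrFun (congrArg Multiplicative.toAdd hu) ⟨q, i⟩)
      exact ⟨c, Ideal.Quotient.eq.1 hc.symm⟩
    choose c hc using hc
    have hne : S.Nonempty := by
      rw [Set.nonempty_iff_ne_empty]
      rintro rfl
      rw [sInf_empty] at hS0
      exact hp.ne_top (eq_top_iff.2 (hS0 ▸ bot_le))
    obtain ⟨q₀, hq₀⟩ := hne
    refine ⟨c ⟨q₀, hq₀⟩, (sub_eq_zero.1 ?_).symm⟩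
    rw [← Ideal.mem_bot, ← hS0, Submodule.mem_sInf]
    intro q hq
    -- The constants on two components differ by an element of the common prime `p`, which contains
    -- no nonzero constant.
    suffices c ⟨q₀, hq₀⟩ = c ⟨q, hq⟩ by rw [this]; exact hc ⟨q, hq⟩
    have hmem := p.sub_mem (hSp q hq (hc ⟨q, hq⟩)) (hSp q₀ hq₀ (hc ⟨q₀, hq₀⟩))
    rw [sub_sub_sub_cancel_left, ← map_sub] at hmem
    by_contra hne
    exact hp.ne_top (Ideal.eq_top_of_isUnit_mem _ hmem
      ((sub_ne_zero.2 hne).isUnit.map (algebraMap k A)))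
  · rintro ⟨c, hc⟩
    have hA : Nontrivial A :=
      ⟨0, 1, fun h ↦ hp.ne_top ((Ideal.eq_top_iff_one p).2 (h ▸ p.zero_mem))⟩
    have hc0 : c ≠ 0 := by
      rintro rfl
      rw [map_zero] at hc
      exact u.ne_zero hc.symm
    have hu : u = Units.map (algebraMap k A : k →* A) (Units.mk0 c hc0) := Units.ext hc.symm
    rw [hu]
    exact DFunLike.congr_fun
      (MonoidHom.eq_one_of_units_isAlgClosed (ψ.comp (Units.map (algebraMap k A : k →* A)))) _

/-! ### Automorphisms of algebras generated by units -/

/-- The automorphism group of an algebra generated by units, whose units modulo constants embed in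
a lattice, is Jordan. -/
lemma isJordanGroup_algEquiv {k A ι : Type*} [Field k] [CommRing A] [Algebra k A] [Finite ι]
    (hA : Algebra.adjoin k {a : A | IsUnit a} = ⊤) (φ : Aˣ →* Multiplicative (ι → ℤ))
    (hφ : ∀ u, φ u = 1 → ∃ c, algebraMap k A c = u) : IsJordanGroup (A ≃ₐ[k] A) := by
  let ρ : (A ≃ₐ[k] A) →* Module.End ℤ (Additive Aˣ) :=
    { toFun g := (Units.map (g : A →* A)).toAdditive.toIntLinearMap
      map_one' := rfl
      map_mul' g h := rfl }
  refine isJordanGroup_of_faithful_end ρ (fun g h hgh ↦ ?_)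
    (MonoidHom.toAdditiveLeft φ).toIntLinearMap (fun g x hx ↦ ?_)
  · have : (g : A →ₐ[k] A) = h := by
      refine AlgHom.ext_of_adjoin_eq_top hA ?_
      rintro _ ⟨u, rfl⟩
      exact congrArg (fun v : Additive Aˣ ↦ (v.toMul : A))
        (LinearMap.congr_fun hgh (Additive.ofMul u))
    exact AlgEquiv.ext fun a ↦ DFunLike.congr_fun this a
  · obtain ⟨c, hc⟩ := hφ x.toMul hx
    refine Additive.toMul.injective (Units.ext ?_)
    change g (x.toMul : A) = x.toMul
    rw [← hc, g.commutes]

/-- The automorphism group of a reduced finitely generated algebra which is generated by units and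
embeds in a local ring is Jordan. -/
lemma isJordanGroup_algEquiv_of_injective_local {k : Type*} {A : Type u} [Field k]
    [IsAlgClosed k] [CharZero k] [CommRing A] [IsReduced A] [Algebra k A] [Algebra.FiniteType k A]
    (hA : Algebra.adjoin k {a : A | IsUnit a} = ⊤) {L : Type*} [CommRing L] [IsLocalRing L]
    (γ : A →+* L) (hγ : Function.Injective γ) : IsJordanGroup (A ≃ₐ[k] A) := by
  have : IsNoetherianRing A := Algebra.FiniteType.isNoetherianRing k A
  have hle (q : Ideal A) (hq : q ∈ minimalPrimes A) :
      q ≤ (IsLocalRing.maximalIdeal L).comap γ := by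
    -- Elements of a minimal prime are zero divisors, and `γ`, being injective, cannot send a zero
    -- divisor to a unit.
    refine fun a ha ↦ (IsLocalRing.mem_maximalIdeal _).2 fun hu ↦ ?_
    refine Set.disjoint_left.1 (Ideal.disjoint_nonZeroDivisors_of_mem_minimalPrimes hq) ha
      (mem_nonZeroDivisors_iff_right.2 fun b hb ↦ hγ ?_)
    rw [map_zero, ← hu.mul_left_eq_zero, ← map_mul, hb, map_zero]
  obtain ⟨ι, hι, φ, hφ⟩ := exists_units_monoidHom_of_iInf_eq_bot (k := k) _ (minimalPrimes A)
    (minimalPrimes.finite_of_isNoetherianRing A) (fun q hq ↦ hq.1.1) hle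
    (by rw [minimalPrimes, Ideal.sInf_minimalPrimes, ← Ideal.zero_eq_bot, ← nilradical,
      nilradical_eq_zero])
  exact isJordanGroup_algEquiv hA φ fun u ↦ (hφ u).1

/-! ### Making the generators invertible -/

/-- A finitely generated algebra with a map to a local ring is generated by finitely many elements
mapping to units. -/
lemma exists_finset_adjoin_eq_top_forall_isUnit (k : Type*) {A L : Type*} [Field k] [CommRing A]
    [Algebra k A] [Algebra.FiniteType k A] [CommRing L] [IsLocalRing L] (γ : A →+* L) :
    ∃ t : Finset A, Algebra.adjoin k (t : Set A) = ⊤ ∧ ∀ a ∈ t, IsUnit (γ a) := by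
  classical
  obtain ⟨T, hT⟩ := Algebra.FiniteType.out (R := k) (A := A)
  -- In a local ring, adding `1` to a nonunit gives a unit.
  refine ⟨T.image fun a ↦ if IsUnit (γ a) then a else a + 1, ?_, ?_⟩
  · rw [eq_top_iff, ← hT, Algebra.adjoin_le_iff]
    intro a ha
    have h := Algebra.subset_adjoin (R := k) (Finset.mem_coe.2 (Finset.mem_image_of_mem
      (fun a ↦ if IsUnit (γ a) then a else a + 1) ha))
    by_cases hu : IsUnit (γ a)
    · simpa only [if_pos hu] using h
    · simp only [if_neg hu] at h
      simpa using sub_mem h (one_mem _)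
  · intro a ha
    obtain ⟨b, -, rfl⟩ := Finset.mem_image.1 ha
    by_cases hu : IsUnit (γ b)
    · rwa [if_pos hu]
    · rw [if_neg hu, map_add, map_one]
      refine (IsLocalRing.isUnit_or_isUnit_of_add_one (a := γ b + 1) (b := - γ b)
        (by ring)).resolve_right ?_
      rwa [IsUnit.neg_iff]

lemma adjoin_insert_invSelf_eq_top {k A B : Type*} [Field k] [CommRing A] [CommRing B]
    [Algebra k A] [Algebra k B] [Algebra A B] [IsScalarTower k A B] (t : Set A)
    (ht : Algebra.adjoin k t = ⊤) (h : A) [IsLocalization.Away h B] :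
    Algebra.adjoin k (insert (IsLocalization.Away.invSelf h) (algebraMap A B '' t)) = ⊤ := by
  set S := Algebra.adjoin k (insert (IsLocalization.Away.invSelf h) (algebraMap A B '' t))
  have hA (a : A) : algebraMap A B a ∈ S := by
    have : Algebra.adjoin k t ≤ S.comap (IsScalarTower.toAlgHom k A B) :=
      Algebra.adjoin_le fun x hx ↦
        Algebra.subset_adjoin (Set.mem_insert_of_mem _ (Set.mem_image_of_mem _ hx))
    exact this (ht ▸ trivial)
  refine eq_top_iff.2 fun b _ ↦ ?_
  obtain ⟨n, a, hb⟩ := IsLocalization.Away.surj h b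
  have : b = algebraMap A B a * IsLocalization.Away.invSelf h ^ n := by
    rw [← hb, mul_assoc, ← mul_pow, IsLocalization.Away.mul_invSelf, one_pow, mul_one]
  rw [this]
  exact mul_mem (hA a) (pow_mem (Algebra.subset_adjoin (Set.mem_insert _ _)) n)

/-! ### From algebras to schemes -/

/-- The structure map from the base field to the global sections of a `k`-scheme. -/
noncomputable def structureHom {k : Type u} [Field k] {Y : Scheme.{u}}
    (g : Y ⟶ Spec (CommRingCat.of k)) : k →+* Γ(Y, ⊤) :=
  ((Scheme.ΓSpecIso (CommRingCat.of k)).inv ≫ g.appTop).hom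

/-- An affine scheme over `k` whose ring of sections is generated by finitely many units is
toral. -/
lemma isToral_of_units {k : Type u} [Field k] {Y : Scheme.{u}} [IsAffine Y]
    (g : Y ⟶ Spec (CommRingCat.of k)) (n : ℕ) (v : Fin n → Γ(Y, ⊤)) (hv : ∀ i, IsUnit (v i))
    (hgen : ∀ R : Subring Γ(Y, ⊤), (structureHom g).range ≤ R → (∀ i, v i ∈ R) → R = ⊤) :
    IsToral g := by
  let j₀ : Y ⟶ affineSpaceOver k n := AffineSpace.homOfVector g (v ∘ ULift.down)
  have hj₀ : j₀ ≫ (affineSpaceOver k n ↘ Spec (CommRingCat.of k)) = g :=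
    AffineSpace.homOfVector_over _ _
  have hcoord (i) : j₀.appTop (AffineSpace.coord _ i) = v i.down :=
    AffineSpace.homOfVector_appTop_coord _ _ _
  have hrange : Set.range j₀ ⊆ Set.range (coordinateComplement k n).ι := by
    rintro _ ⟨y, rfl⟩
    rw [Scheme.Opens.range_ι, coordinateComplement, TopologicalSpace.Opens.coe_iInf, Set.mem_iInter]
    intro i
    have : y ∈ j₀ ⁻¹ᵁ (affineSpaceOver k n).basicOpen (AffineSpace.coord _ i) := by
      rw [Scheme.preimage_basicOpen_top, hcoord, Scheme.basicOpen_of_isUnit _ (hv i.down)]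
      trivial
    exact this
  have hclosed : IsClosedImmersion j₀ := by
    refine IsClosedImmersion.of_surjective_of_isAffine j₀ (RingHom.range_eq_top.1
      (hgen j₀.appTop.hom.range ?_ fun i ↦ ⟨_, hcoord ⟨i⟩⟩))
    rintro _ ⟨c, rfl⟩
    refine ⟨structureHom (affineSpaceOver k n ↘ Spec (CommRingCat.of k)) c, ?_⟩
    rw [structureHom, structureHom, ← RingHom.comp_apply, ← CommRingCat.hom_comp, Category.assoc,
      ← Scheme.Hom.comp_appTop, hj₀]
  refine ⟨n, IsOpenImmersion.lift (coordinateComplement k n).ι j₀ hrange, ?_, ?_⟩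
  -- The image is closed in all of affine space, hence also in the open complement.
  · have : IsClosedImmersion (IsOpenImmersion.lift (coordinateComplement k n).ι j₀ hrange ≫
        (coordinateComplement k n).ι) := by rwa [IsOpenImmersion.lift_fac]
    exact IsClosedImmersion.of_comp _ (coordinateComplement k n).ι
  · rw [IsOpenImmersion.lift_fac_assoc, hj₀]

/-- The automorphism group of an affine `k`-scheme is Jordan if that of its algebra of global
sections is. -/
lemma isJordanGroup_autOver_of_isAffine {k : Type u} [Field k] {Y : Scheme.{u}} [IsAffine Y]
    (g : Y ⟶ Spec (CommRingCat.of k)) [Algebra k Γ(Y, ⊤)]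
    (halg : algebraMap k Γ(Y, ⊤) = structureHom g)
    (h : IsJordanGroup (Γ(Y, ⊤) ≃ₐ[k] Γ(Y, ⊤))) : IsJordanGroup (AutOver g) := by
  have hcomm (a : Over.mk g ⟶ Over.mk g) (c : k) :
      a.left.appTop (algebraMap k Γ(Y, ⊤) c) = algebraMap k Γ(Y, ⊤) c := by
    have hw : a.left ≫ g = g := Over.w a
    rw [halg, structureHom]
    conv_rhs => rw [← hw, Scheme.Hom.comp_appTop, ← Category.assoc]
    rfl
  have hinv (a b : Over.mk g ⟶ Over.mk g) (hab : a ≫ b = 𝟙 _) (s : Γ(Y, ⊤)) :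
      a.left.appTop (b.left.appTop s) = s := by
    have h1 : a.left ≫ b.left = 𝟙 Y := congrArg CommaMorphism.left hab
    have h2 := congrArg (fun m : Y ⟶ Y ↦ m.appTop s) h1
    rwa [Scheme.Hom.comp_appTop, CommRingCat.comp_apply, Scheme.Hom.id_appTop] at h2
  let F : AutOver g →* (Γ(Y, ⊤) ≃ₐ[k] Γ(Y, ⊤)) :=
    -- Pullback reverses composition, so `a` acts on functions by pullback along its inverse.
    { toFun a := AlgEquiv.ofRingEquiv (f := RingEquiv.ofRingHom a.inv.left.appTop.hom
        a.hom.left.appTop.hom (RingHom.ext (hinv _ _ a.inv_hom_id))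
        (RingHom.ext (hinv _ _ a.hom_inv_id))) (hcomm a.inv)
      map_one' := by
        ext s
        exact hinv (𝟙 _) (𝟙 _) (Category.comp_id _) s
      map_mul' a b := by
        ext s
        change (a.inv.left ≫ b.inv.left).appTop s = _
        rw [Scheme.Hom.comp_appTop]
        rfl }
  refine h.of_injective F fun a b hab ↦ ?_
  have h1 : a.inv.left = b.inv.left := ext_of_isAffine (Y := Y)
    (CommRingCat.hom_ext (RingHom.ext fun s ↦
    DFunLike.congr_fun hab s))
  have h2 : a.inv = b.inv := Over.OverMorphism.ext h1
  exact inv_injective (Iso.ext h2)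

/-- Pulling back global functions to an open subscheme `U` through a larger open `V`. -/
lemma appLE_comp_map_comp_topIso_inv {X Y : Scheme.{u}} (f : X ⟶ Y) (U V : X.Opens) (hUV : U ≤ V) :
    f.appLE ⊤ V le_top ≫ X.presheaf.map (homOfLE hUV).op ≫ U.topIso.inv = (U.ι ≫ f).appTop := by
  rw [Scheme.Hom.comp_appTop, Scheme.Opens.ι_appTop]
  refine (Category.assoc _ _ _).trans (congrArg (f.app ⊤ ≫ ·) ?_)
  exact ((congrArg (_ ≫ ·) (X.presheaf.map_comp _ _).symm).trans (X.presheaf.map_comp _ _).symm)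

theorem mainTheorem8 (k : Type u) [Field k] [IsAlgClosed k] [CharZero k]
    (X : Scheme.{u}) (f : X ⟶ Spec (CommRingCat.of k)) (hX : IsAlgebraicVariety f) (x : X) :
    ∃ U : X.Opens, x ∈ U ∧ IsToral (U.ι ≫ f) ∧ IsJordanGroup (AutOver (U.ι ≫ f)) := by
  have := hX.reduced
  have := hX.locallyOfFiniteType
  have : IsLocallyNoetherian X := LocallyOfFiniteType.isLocallyNoetherian f
  obtain ⟨V, hxV, hV, hinj⟩ := X.exists_germ_injective x
  let κ : k →+* Γ(X, V) := ((Scheme.ΓSpecIso (CommRingCat.of k)).inv ≫ f.appLE ⊤ V le_top).hom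
  have hκ : κ.FiniteType := by
    refine RingHom.FiniteType.comp (f.finiteType_appLE (isAffineOpen_top _) hV le_top) ?_
    exact RingHom.FiniteType.of_surjective _
      (Scheme.ΓSpecIso (CommRingCat.of k)).symm.commRingCatIsoToRingEquiv.surjective
  algebraize [κ]
  obtain ⟨t, ht, htu⟩ :=
    exists_finset_adjoin_eq_top_forall_isUnit k (X.presheaf.germ V x hxV).hom
  -- Inverting `h` makes every generator in `t` a unit and keeps `x`, where they are all units
  -- already.
  let h : Γ(X, V) := ∏ a ∈ t, a
  let U := X.basicOpen h
  have hxU : x ∈ U := by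
    refine (X.mem_basicOpen h x hxV).2 ?_
    change IsUnit ((X.presheaf.germ V x hxV).hom h)
    rw [map_prod]
    exact (IsUnit.prod_iff).2 htu
  have hUaff : IsAffine U := hV.basicOpen h
  let e : Γ(X, U) ≃+* Γ(U, ⊤) := U.topIso.symm.commRingCatIsoToRingEquiv
  let r : Γ(X, V) →+* Γ(U, ⊤) := e.toRingHom.comp (algebraMap Γ(X, V) Γ(X, X.basicOpen h))
  algebraize [r, structureHom (U.ι ≫ f)]
  have hloc : IsLocalization.Away h Γ(U, ⊤) :=
    (IsLocalization.isLocalization_iff_of_ringEquiv _ e).1 (hV.isLocalization_basicOpen h)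
  have hrκ : structureHom (U.ι ≫ f) = r.comp κ := by
    change _ = ((Scheme.ΓSpecIso (CommRingCat.of k)).inv ≫ f.appLE ⊤ V le_top ≫
      X.presheaf.map (homOfLE (X.basicOpen_le h)).op ≫ U.topIso.inv).hom
    rw [appLE_comp_map_comp_topIso_inv]
    rfl
  have : IsScalarTower k Γ(X, V) Γ(U, ⊤) := .of_algebraMap_eq' hrκ
  -- The inverse of `h` is the one extra generator needed after localizing, and it too is a unit.
  let T : Set Γ(U, ⊤) := insert (IsLocalization.Away.invSelf h) (algebraMap Γ(X, V) Γ(U, ⊤) '' t)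
  have hTfin : T.Finite := (t.finite_toSet.image _).insert _
  have hTtop : Algebra.adjoin k T = ⊤ := adjoin_insert_invSelf_eq_top (k := k) (B := Γ(U, ⊤)) _ ht h
  have hTunit : ∀ b ∈ T, IsUnit b := by
    rintro _ (rfl | ⟨a, ha, rfl⟩)
    · exact .of_mul_eq_one_right _ (IsLocalization.Away.mul_invSelf h)
    · exact isUnit_of_dvd_unit (map_dvd _ (Finset.dvd_prod_of_mem _ ha))
        (IsLocalization.Away.algebraMap_isUnit h)
  refine ⟨U, hxU, ?_, ?_⟩
  · have := hTfin.to_subtype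
    let n := Nat.card T
    let ε : T ≃ Fin n := Finite.equivFin T
    refine isToral_of_units _ n (fun i ↦ (ε.symm i).1) (fun i ↦ hTunit _ (ε.symm i).2)
      fun R hR hRv ↦ eq_top_iff.2 fun b _ ↦ ?_
    have hb : b ∈ Algebra.adjoin k T := hTtop ▸ trivial
    induction hb using Algebra.adjoin_induction with
    | mem b hb => simpa using hRv (ε ⟨b, hb⟩)
    | algebraMap c => exact hR ⟨c, rfl⟩
    | add _ _ _ _ h₁ h₂ => exact add_mem (h₁ trivial) (h₂ trivial)
    | mul _ _ _ _ h₁ h₂ => exact mul_mem (h₁ trivial) (h₂ trivial)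
  · have : Algebra.FiniteType k Γ(U, ⊤) := ⟨⟨hTfin.toFinset, by simpa using hTtop⟩⟩
    refine isJordanGroup_autOver_of_isAffine _ rfl
      (isJordanGroup_algEquiv_of_injective_local ?_
        ((X.presheaf.germ U x hxU).hom.comp e.symm.toRingHom) ?_)
    · exact eq_top_iff.2 (hTtop ▸ Algebra.adjoin_mono hTunit)
    · exact (injective_germ_basicOpen V hV x hxV h hxU hinj).comp e.symm.injective
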